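/- Cells are elements $(i,j)\in\mathbb Z^2$ in matrix coordinates (row $i$, column $j$). For a finite $S\subset\mathbb Z^2$, $SYT(S)$ is the set of injective maps $f:S\to\{1,\dots,|S|\}$ with $f(i,j)<f(i,j+1)$ and $f(i,j)<f(i+1,j)$ whenever both cells lie in $S$. A \emph{periodic shape} is a finite set $P\subset\mathbb Z^2$ containing $(1,1)$ which is (up to translation) a connected skew shape $\lambda/\mu$ in French notation and in which every column other than the left-most and right-most ones contains a cell $(i,j)$ with $(i,j-1),(i,j+1)\in P$. For an integer $w\ge 0$ let $\nabla=b-a+(1,w)$, where $a$ and $b$ are the left-most cells of the top and of the bottom row of $P$, and for $m\ge 1$ let $Sh^w(P,m)=\bigcup_{i=0}^{m-1}(P+i\nabla)$. The pair $(P,w)$ is \emph{compatible} if $P$ is a periodic shape, $Sh^w(P,m)$ is a periodic shape for all $m\ge1$, and the number of cells in a column of $Sh^w(P,m)$ is bounded independently of $m$. For a compatible pair and $m$ large, put $u=a+(m-1)\nabla-(1,0)+\nabla$, write $u=(i_0,j_0)$, and let the index shape $I(P,w)$ be the set consisting of $u$ and all $(i,j)\in Sh^w(P,m)$ with $i\le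 i_0$, $j>j_0$, translated so that its top row is row $1$ and its left-most column is column $1$ (for large $m$ this does not depend on $m$). Let $N(P,w)$ be the smallest $m\ge 1$ such that $I(P,w)+v\subseteq Sh^w(P,m)$ for some $v\in\mathbb Z^2$. **Proposition.** Let $R$ be a single row of cells containing $(1,1)$ and let $w\ge 0$ be an integer such that $(R,w)$ is compatible and $|R|\le 3w+1$. Then the sequence $A(n)=|SYT(Sh^w(R,n))|$, $n\ge1$, satisfies for $n\ge N(R,w)$ a constant-coefficient linear recurrence of order at most $\max(1,\,|R|-2w)$. That is, there are an integer $d$ with $1\le d\le\max(1,|R|-2w)$ and constants $c_1,\dots,c_d\in\mathbb R$ such that $$A(n)=\sum_{k=1}^{d}c_k\,A(n-k)\qquad\text{for all } n\ge N(R,w)\text{ with } n>d .$$ (The condition $n>d$ only says that all terms $A(n-k)$ are terms of the sequence.) -/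

import Mathlib

namespace PeriodicSYT

/-- A cell `(i, j)` of the integer lattice: row `i` (increasing downwards), column `j`
(increasing to the right), i.e. matrix coordinates. -/
abbrev Cell : Type := ℤ × ℤ

/-- The translate `v + S` of a finite set of cells. -/
def shiftCells (v : Cell) (S : Finset Cell) : Finset Cell := S.image (fun c => v + c)

/-! ### Standard Young tableaux -/

/-- The standard Young tableaux of shape `S`: injective fillings of `S` with entries in
`{1, …, |S|}` that increase between horizontally adjacent cells and between vertically
adjacent cells of `S`. -/
def SYT (S : Finset Cell) : Set ({c : Cell // c ∈ S} → ℕ) :=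
  {f | Function.Injective f ∧
    (∀ c, 1 ≤ f c ∧ f c ≤ S.card) ∧
    (∀ (i j : ℤ) (h : (i, j) ∈ S) (h' : (i, j + 1) ∈ S), f ⟨(i, j), h⟩ < f ⟨(i, j + 1), h'⟩) ∧
    (∀ (i j : ℤ) (h : (i, j) ∈ S) (h' : (i + 1, j) ∈ S), f ⟨(i, j), h⟩ < f ⟨(i + 1, j), h'⟩)}

/-- The number of standard Young tableaux of shape `S`. -/
noncomputable def numSYT (S : Finset Cell) : ℕ := (SYT S).ncard

/-! ### Periodic shapes -/

/-- Any two cells of `S` are joined by a path of horizontal and vertical unit steps in `S`. -/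
def IsConnectedShape (S : Finset Cell) : Prop :=
  ∀ u ∈ S, ∀ v ∈ S, Relation.ReflTransGen
    (fun a b : Cell => b ∈ S ∧ b - a ∈ ({(1, 0), (0, 1), (-1, 0), (0, -1)} : Set Cell)) u v

/-- `S` is, up to its position in the lattice, the diagram of a skew shape `lam / mu` in French
notation: the rows of the diagram are stacked upwards, the first row at the bottom. -/
def IsFrenchSkewShape (S : Finset Cell) : Prop :=
  ∃ (lam mu : YoungDiagram) (t : Cell), mu ≤ lam ∧
    S = (lam.cells \ mu.cells).image (fun c => ((t.1 - (c.1 : ℤ), t.2 + (c.2 : ℤ)) : Cell))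

/-- Periodic shapes: connected French skew shapes containing `(1, 1)` such that each column
other than the left-most and the right-most one has a cell whose left and right neighbours both
lie in the shape. -/
def IsPeriodicShape (P : Finset Cell) : Prop :=
  ((1, 1) : Cell) ∈ P ∧ IsFrenchSkewShape P ∧ IsConnectedShape P ∧
    ∀ j : ℤ, (∃ c ∈ P, c.2 = j) → (∃ c ∈ P, c.2 < j) → (∃ c ∈ P, j < c.2) →
      ∃ i : ℤ, (i, j) ∈ P ∧ (i, j - 1) ∈ P ∧ (i, j + 1) ∈ P

/-- Index of the top row of a nonempty finite set of cells. -/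
noncomputable def topRow (P : Finset Cell) : ℤ := sInf {i : ℤ | ∃ j, (i, j) ∈ P}

/-- Index of the bottom row of a nonempty finite set of cells. -/
noncomputable def bottomRow (P : Finset Cell) : ℤ := sSup {i : ℤ | ∃ j, (i, j) ∈ P}

/-- Index of the left-most column of a nonempty finite set of cells. -/
noncomputable def leftCol (P : Finset Cell) : ℤ := sInf {j : ℤ | ∃ i, (i, j) ∈ P}

/-- The left-most cell in the (nonempty) row `i` of `P`. -/
noncomputable def leftmostInRow (P : Finset Cell) (i : ℤ) : Cell := (i, sInf {j : ℤ | (i, j) ∈ P})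

/-- The shift vector `b - a + (1, w)`, with `a` the left-most cell of the top row of `P` and `b`
the left-most cell of the bottom row of `P`. -/
noncomputable def shiftVec (P : Finset Cell) (w : ℕ) : Cell :=
  leftmostInRow P (bottomRow P) - leftmostInRow P (topRow P) + (1, (w : ℤ))

/-- The shape `Sh^w(P, m)`: the union of the `m` translates of `P` by `0, ∇, …, (m - 1) ∇`,
where `∇` is the shift vector of `P` and `w`. -/
noncomputable def Sh (w : ℕ) (P : Finset Cell) (m : ℕ) : Finset Cell :=
  (Finset.range m).biUnion (fun i => shiftCells ((i : ℤ) • shiftVec P w) P)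

/-- `(P, w)` is a compatible pair: `P` is periodic, every `Sh^w(P, n)` is periodic, and the
number of cells in a column of `Sh^w(P, n)` is bounded independently of `n`. -/
def IsCompatible (P : Finset Cell) (w : ℕ) : Prop :=
  IsPeriodicShape P ∧
  (∀ n : ℕ, 1 ≤ n → IsPeriodicShape (Sh w P n)) ∧
  ∃ B : ℕ, ∀ n : ℕ, 1 ≤ n → ∀ j : ℤ, ((Sh w P n).filter (fun c => c.2 = j)).card ≤ B

/-! ### The index shape and the threshold `N(P, w)` -/

/-- The translate of a nonempty `Q` that lies in the quadrant of positive coordinates and touches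
both row `1` and column `1`. -/
noncomputable def normalize (Q : Finset Cell) : Finset Cell :=
  shiftCells (1 - topRow Q, 1 - leftCol Q) Q

/-- The corner of `S` generated by the cell `v ∈ S`: the cell `v` itself and the cells of `S`
weakly above and strictly to the right of `v`. -/
def corner (S : Finset Cell) (v : Cell) : Finset Cell :=
  S.filter (fun c => c = v ∨ (c.1 ≤ v.1 ∧ v.2 < c.2))

/-- The cell `u` of the bottom row of `Sh^w(P, m)` with `u - ∇ = v - (1, 0)`, where `v` is the
left-most cell of the top row of the last translate `P + (m - 1) ∇`. -/
noncomputable def cornerCell (P : Finset Cell) (w m : ℕ) : Cell :=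
  leftmostInRow P (topRow P) + ((m : ℤ) - 1) • shiftVec P w - (1, 0) + shiftVec P w

/-- `I` is the index shape of `(P, w)`: for all sufficiently large `m` it is the normalized
corner of `Sh^w(P, m)` generated by `cornerCell P w m`. -/
def IsIndexShape (P : Finset Cell) (w : ℕ) (I : Finset Cell) : Prop :=
  ∀ᶠ m : ℕ in Filter.atTop, I = normalize (corner (Sh w P m) (cornerCell P w m))

/-- `N(P, w)`: the smallest positive `m` such that some translate of the index shape of `(P, w)`
is contained in `Sh^w(P, m)`. -/
noncomputable def threshold (P : Finset Cell) (w : ℕ) : ℕ :=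
  sInf {m : ℕ | 1 ≤ m ∧ ∃ I : Finset Cell, IsIndexShape P w I ∧
    ∃ v : Cell, shiftCells v I ⊆ Sh w P m}

/-- `R` is contained in a single row. -/
def IsSingleRow (R : Finset Cell) : Prop := ∀ c ∈ R, ∀ c' ∈ R, c.1 = c'.1

end PeriodicSYT

/-! Write `r` for the length of the row. The shape is a staircase of rows of length `r`, each
shifted `w` to the right of the one above, and its tableaux are linear extensions of the cell order.
Split each one at the position-`w` cell `u` of the last row (positions from 0): the predecessors of
`u` form a lower set `D`, and the labellings of `D` and of the rest are independent
(`numLinExt_eq_sum`).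

Because `r ≤ 3 * w + 1`, the set `D` contains every row except the pivot row and the one above it;
it has exactly `w` cells of the pivot row and misses only some final `s` cells of the row above,
with `s < max 1 (r - 2 * w)` (`exists_cutStack_eq`). The part after `u` depends on `s` but not on
the height (`numLinExt_stack_sdiff`), while `D` is a shorter staircase with modified last rows
(`cutStack_succ`), which can be split again. So the counts indexed by `s` evolve by a fixed transfer
matrix of size `max 1 (r - 2 * w)`, and Cayley-Hamilton gives the recurrence. -/

namespace PeriodicSYT

/-! ### Splitting linear extensions at an element. -/

section LinearExtensions

variable {α β : Type*}

/-- The linear extensions of the relation `rel` on the finite set `S`, as bijective labellings of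
`S` by `1, …, |S|` that are extended by zero. -/
def LinExt (rel : α → α → Prop) (S : Finset α) : Set (α → ℕ) :=
  {f | (∀ c, c ∉ S → f c = 0) ∧ (∀ a ∈ S, ∀ b ∈ S, f a = f b → a = b) ∧
    (∀ c ∈ S, 1 ≤ f c ∧ f c ≤ S.card) ∧ ∀ a ∈ S, ∀ b ∈ S, rel a b → f a < f b}

/-- The number of linear extensions of `rel` on `S`. -/
noncomputable def numLinExt (rel : α → α → Prop) (S : Finset α) : ℕ := (LinExt rel S).ncard

theorem finite_linExt (rel : α → α → Prop) (S : Finset α) : (LinExt rel S).Finite := by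
  refine Set.Finite.of_finite_image (f := fun f (c : {c // c ∈ S}) => f c) ?_ ?_
  · refine (Set.Finite.pi' (t := fun _ : {c // c ∈ S} => Set.Iic S.card)
      (fun _ => Set.finite_Iic _)).subset ?_
    rintro _ ⟨f, hf, rfl⟩ c
    exact (hf.2.2.1 c c.2).2
  · intro f hf g hg h
    funext c
    by_cases hc : c ∈ S
    · exact congrFun h ⟨c, hc⟩
    · rw [hf.1 c hc, hg.1 c hc]

theorem numLinExt_map {rel : α → α → Prop} {rel' : β → β → Prop} (φ : α ↪ β) (S : Finset α)
    (hφ : ∀ a ∈ S, ∀ b ∈ S, rel' (φ a) (φ b) ↔ rel a b) :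
    numLinExt rel' (S.map φ) = numLinExt rel S := by
  refine Set.ncard_congr (fun f _ => f ∘ φ) ?_ ?_ ?_
  · rintro f ⟨h0, hinj, hr, hm⟩
    refine ⟨fun c hc => h0 _ (by simpa using hc), ?_, ?_, ?_⟩
    · intro a ha b hb h
      exact φ.injective (hinj _ (by simpa using ha) _ (by simpa using hb) h)
    · intro c hc
      simpa using hr (φ c) (by simpa using hc)
    · intro a ha b hb h
      exact hm _ (by simpa using ha) _ (by simpa using hb) ((hφ a ha b hb).2 h)
  · intro f g hf hg h
    funext c
    by_cases hc : c ∈ S.map φ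
    · obtain ⟨a, _, rfl⟩ := Finset.mem_map.1 hc
      exact congrFun h a
    · rw [hf.1 c hc, hg.1 c hc]
  · rintro g ⟨h0, hinj, hr, hm⟩
    have hg : ∀ a, Function.extend φ g 0 (φ a) = g a := fun a => φ.injective.extend_apply _ _ _
    refine ⟨Function.extend φ g 0, ⟨?_, ?_, ?_, ?_⟩, funext hg⟩
    · intro c hc
      by_cases h : ∃ a, φ a = c
      · obtain ⟨a, rfl⟩ := h
        rw [hg]
        exact h0 a (by simpa using hc)
      · exact Function.extend_apply' _ _ _ h
    · intro a ha b hb h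
      obtain ⟨a, ha', rfl⟩ := Finset.mem_map.1 ha
      obtain ⟨b, hb', rfl⟩ := Finset.mem_map.1 hb
      rw [hg, hg] at h
      rw [hinj a ha' b hb' h]
    · intro c hc
      obtain ⟨c, hc', rfl⟩ := Finset.mem_map.1 hc
      rw [hg, Finset.card_map]
      exact hr c hc'
    · intro a ha b hb h
      obtain ⟨a, ha', rfl⟩ := Finset.mem_map.1 ha
      obtain ⟨b, hb', rfl⟩ := Finset.mem_map.1 hb
      rw [hg, hg]
      exact hm a ha' b hb' ((hφ a ha' b hb').1 h)

/-- An injective labelling into `1, …, |S|` uses every label, so exactly the labels `1, …, f u - 1`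
occur before `u`. -/
theorem card_filter_lt_of_mem_linExt {rel : α → α → Prop} {S : Finset α} {f : α → ℕ}
    (hf : f ∈ LinExt rel S) {u : α} (hu : u ∈ S) :
    (S.filter (fun c => f c < f u)).card + 1 = f u := by
  obtain ⟨-, hinj, hr, -⟩ := hf
  have himg : S.image f = Finset.Icc 1 S.card := by
    refine Finset.eq_of_subset_of_card_le ?_ ?_
    · intro k hk
      obtain ⟨c, hc, rfl⟩ := Finset.mem_image.1 hk
      exact Finset.mem_Icc.2 (hr c hc)
    · rw [Finset.card_image_of_injOn (fun a ha b hb => hinj a ha b hb)]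
      simp
  have himg' : (S.filter (fun c => f c < f u)).image f = Finset.Ico 1 (f u) := by
    ext k
    simp only [Finset.mem_image, Finset.mem_filter, Finset.mem_Ico]
    constructor
    · rintro ⟨c, ⟨hc, hlt⟩, rfl⟩
      exact ⟨(hr c hc).1, hlt⟩
    · rintro ⟨h1, h2⟩
      have hk : k ∈ S.image f := by
        rw [himg, Finset.mem_Icc]
        exact ⟨h1, h2.le.trans (hr u hu).2⟩
      obtain ⟨c, hc, rfl⟩ := Finset.mem_image.1 hk
      exact ⟨c, ⟨hc, h2⟩, rfl⟩
  have hcard := congrArg Finset.card himg'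
  rw [Finset.card_image_of_injOn, Nat.card_Ico] at hcard
  · have := (hr u hu).1
    omega
  · intro a ha b hb
    exact hinj a (Finset.mem_filter.1 ha).1 b (Finset.mem_filter.1 hb).1

/-- `D` is a possible set of predecessors of `u` in a linear extension of `rel` on `S`. -/
structure IsCut (rel : α → α → Prop) (S : Finset α) (u : α) (D : Finset α) : Prop where
  subset : D ⊆ S
  notMem : u ∉ D
  lower : ∀ a ∈ S, ∀ b ∈ D, rel a b → a ∈ D
  below : ∀ a ∈ S, rel a u → a ∈ D

theorem isCut_filter_lt {rel : α → α → Prop} {S : Finset α} {f : α → ℕ}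
    (hf : f ∈ LinExt rel S) {u : α} (hu : u ∈ S) :
    IsCut rel S u (S.filter (fun c => f c < f u)) := by
  refine ⟨Finset.filter_subset _ _, by simp, ?_, ?_⟩
  · intro a ha b hb h
    rw [Finset.mem_filter] at hb ⊢
    exact ⟨ha, (hf.2.2.2 a ha b hb.1 h).trans hb.2⟩
  · intro a ha h
    exact Finset.mem_filter.2 ⟨ha, hf.2.2.2 a ha u hu h⟩

variable [DecidableEq α]

/-- Concatenation of a labelling of `D`, of the cell `u`, and of a labelling of the other elements
of `S`. -/
def glue (S : Finset α) (u : α) (D : Finset α) (g h : α → ℕ) (c : α) : ℕ :=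
  if c ∈ D then g c else if c = u then D.card + 1 else if c ∈ S then h c + (D.card + 1) else 0

theorem glue_mem_linExt {rel : α → α → Prop} {S D : Finset α} {u : α} (hu : u ∈ S)
    (hrel : ¬ rel u u) (hD : IsCut rel S u D) {g h : α → ℕ} (hg : g ∈ LinExt rel D)
    (hh : h ∈ LinExt rel (S \ insert u D)) : glue S u D g h ∈ LinExt rel S := by
  obtain ⟨-, ginj, gr, gm⟩ := hg
  obtain ⟨-, hinj, hr, hm⟩ := hh
  have hmem : ∀ c ∈ S, c ∉ D → c ≠ u → c ∈ S \ insert u D := fun c h1 h2 h3 => by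
    simp [h1, h2, h3]
  have hcard : (S \ insert u D).card + (D.card + 1) = S.card := by
    rw [← Finset.card_insert_of_notMem hD.notMem]
    exact Finset.card_sdiff_add_card_eq_card (Finset.insert_subset hu hD.subset)
  refine ⟨?_, ?_, ?_, ?_⟩
  · intro c hc
    have h1 : c ∉ D := fun h => hc (hD.subset h)
    have h2 : c ≠ u := fun h => hc (h ▸ hu)
    simp [glue, h1, h2, hc]
  · intro a ha b hb hab
    by_cases haD : a ∈ D <;> by_cases hbD : b ∈ D
    · exact ginj a haD b hbD (by simpa [glue, haD, hbD] using hab)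
    · have := gr a haD
      by_cases hbu : b = u <;> simp [glue, haD, hbD, hbu, hb, hD.notMem] at hab <;> omega
    · have := gr b hbD
      by_cases hau : a = u <;> simp [glue, haD, hbD, hau, ha, hD.notMem] at hab <;> omega
    · by_cases hau : a = u <;> by_cases hbu : b = u
      · rw [hau, hbu]
      · have := hr b (hmem b hb hbD hbu)
        simp [glue, hbD, hau, hbu, hb, hD.notMem] at hab
        omega
      · have := hr a (hmem a ha haD hau)
        simp [glue, haD, hau, hbu, ha, hD.notMem] at hab
        omega
      · refine hinj a (hmem a ha haD hau) b (hmem b hb hbD hbu) ?_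
        simpa [glue, haD, hbD, hau, hbu, ha, hb] using hab
  · intro c hc
    by_cases hcD : c ∈ D
    · have := gr c hcD
      simp only [glue, hcD, if_true]
      omega
    · by_cases hcu : c = u
      · simp only [glue, hcu, hD.notMem, if_true, if_false]
        omega
      · have := hr c (hmem c hc hcD hcu)
        simp only [glue, hcD, hcu, hc, if_true, if_false]
        omega
  · intro a ha b hb hab
    by_cases hbD : b ∈ D
    · have haD := hD.lower a ha b hbD hab
      simpa [glue, haD, hbD] using gm a haD b hbD hab
    · by_cases hbu : b = u
      · subst hbu
        have haD := hD.below a ha hab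
        have := gr a haD
        simp only [glue, haD, hbD, if_true, if_false]
        omega
      · have h1 := hr b (hmem b hb hbD hbu)
        by_cases haD : a ∈ D
        · have := gr a haD
          simp only [glue, haD, hbD, hbu, hb, if_true, if_false]
          omega
        · by_cases hau : a = u
          · simp only [glue, hau, hbD, hbu, hb, hD.notMem, if_true, if_false]
            omega
          · have := hm a (hmem a ha haD hau) b (hmem b hb hbD hbu) hab
            simp only [glue, haD, hau, ha, hbD, hbu, hb, if_true, if_false]
            omega

theorem filter_glue_lt {rel : α → α → Prop} {S D : Finset α} {u : α}
    (hD : IsCut rel S u D) {g h : α → ℕ} (hg : g ∈ LinExt rel D) :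
    S.filter (fun c => glue S u D g h c < glue S u D g h u) = D := by
  ext c
  rw [Finset.mem_filter]
  have hu : glue S u D g h u = D.card + 1 := by simp [glue, hD.notMem]
  rw [hu]
  constructor
  · rintro ⟨hc, hlt⟩
    by_contra hcD
    by_cases hcu : c = u <;> (simp [glue, hcD, hcu, hc, hD.notMem] at hlt; try omega)
  · intro hc
    have := hg.2.2.1 c hc
    refine ⟨hD.subset hc, ?_⟩
    simp only [glue, hc, if_true]
    omega

/-- Once `D` is fixed, `u` must carry the label `|D| + 1`, and `glue` is a bijection from pairs of
labellings. -/
theorem ncard_linExt_filter_eq {rel : α → α → Prop} {S D : Finset α} {u : α} (hu : u ∈ S)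
    (hrel : ¬ rel u u) (hD : IsCut rel S u D) :
    {f ∈ LinExt rel S | S.filter (fun c => f c < f u) = D}.ncard =
      numLinExt rel D * numLinExt rel (S \ insert u D) := by
  rw [numLinExt, numLinExt, ← Set.ncard_prod]
  symm
  have hcD : ∀ c ∈ S \ insert u D, c ∈ S ∧ c ≠ u ∧ c ∉ D := fun c hc => by
    simpa using hc
  refine Set.ncard_congr (fun p _ => glue S u D p.1 p.2) ?_ ?_ ?_
  · rintro ⟨g, h⟩ ⟨hg, hh⟩
    exact ⟨glue_mem_linExt hu hrel hD hg hh, filter_glue_lt hD hg⟩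
  · rintro ⟨g, h⟩ ⟨g', h'⟩ ⟨hg, hh⟩ ⟨hg', hh'⟩ heq
    refine Prod.ext (funext fun c => ?_) (funext fun c => ?_)
    · by_cases hc : c ∈ D
      · simpa [glue, hc] using congrFun heq c
      · exact (hg.1 c hc).trans (hg'.1 c hc).symm
    · by_cases hc : c ∈ S \ insert u D
      · obtain ⟨h1, h2, h3⟩ := hcD c hc
        simpa [glue, h1, h2, h3] using congrFun heq c
      · exact (hh.1 c hc).trans (hh'.1 c hc).symm
  · rintro f ⟨hf, hfD⟩
    have hfu := card_filter_lt_of_mem_linExt hf hu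
    rw [hfD] at hfu
    have hlt : ∀ c ∈ S, (c ∈ D ↔ f c < f u) := fun c hc => by
      rw [← hfD, Finset.mem_filter]
      exact ⟨fun h => h.2, fun h => ⟨hc, h⟩⟩
    have hgt : ∀ c ∈ S, c ≠ u → c ∉ D → f u < f c := fun c hc hcu hcD => by
      rw [hlt c hc] at hcD
      have : f c ≠ f u := fun h => hcu (hf.2.1 c hc u hu h)
      omega
    have hcard : (S \ insert u D).card + (D.card + 1) = S.card := by
      rw [← Finset.card_insert_of_notMem hD.notMem]
      exact Finset.card_sdiff_add_card_eq_card (Finset.insert_subset hu hD.subset)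
    obtain ⟨f0, finj, fr, fm⟩ := hf
    -- The inverse of `glue`; the subtraction does not truncate, since `f u < f c` outside `insert u
    -- D`.
    refine ⟨(fun c => if c ∈ D then f c else 0,
      fun c => if c ∈ S \ insert u D then f c - f u else 0), ⟨⟨?_, ?_, ?_, ?_⟩, ⟨?_, ?_, ?_, ?_⟩⟩, ?_⟩
    · intro c hc
      simp [hc]
    · intro a ha b hb hab
      simp only [ha, hb, if_true] at hab
      exact finj a (hD.subset ha) b (hD.subset hb) hab
    · intro c hc
      have h1 := fr c (hD.subset hc)
      have h2 := (hlt c (hD.subset hc)).1 hc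
      simp only [hc, if_true]
      omega
    · intro a ha b hb hab
      simp only [ha, hb, if_true]
      exact fm a (hD.subset ha) b (hD.subset hb) hab
    · intro c hc
      simp only [hc, if_false]
    · intro a ha b hb hab
      obtain ⟨a1, a2, a3⟩ := hcD a ha
      obtain ⟨b1, b2, b3⟩ := hcD b hb
      have ha' := hgt a a1 a2 a3
      have hb' := hgt b b1 b2 b3
      simp only [ha, hb, if_true] at hab
      exact finj a a1 b b1 (by omega)
    · intro c hc
      obtain ⟨c1, c2, c3⟩ := hcD c hc
      have h1 := hgt c c1 c2 c3
      have h2 := fr c c1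
      simp only [hc, if_true]
      omega
    · intro a ha b hb hab
      obtain ⟨a1, a2, a3⟩ := hcD a ha
      obtain ⟨b1, b2, b3⟩ := hcD b hb
      have ha' := hgt a a1 a2 a3
      have := fm a a1 b b1 hab
      simp only [ha, hb, if_true]
      omega
    · funext c
      by_cases hcD' : c ∈ D
      · simp [glue, hcD']
      · by_cases hcu : c = u
        · subst hcu
          simp [glue, hcD', hfu]
        · by_cases hcS : c ∈ S
          · have := hgt c hcS hcu hcD'
            simp only [glue, hcD', hcu, hcS, if_true, if_false, Finset.mem_sdiff,
              Finset.mem_insert, or_self, not_false_eq_true, and_self]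
            omega
          · simp [glue, hcD', hcu, hcS, f0 c hcS]

/-- Linear extensions are counted by splitting them at an element `u`. -/
theorem numLinExt_eq_sum {ι : Type*} {rel : α → α → Prop} {S : Finset α} {u : α} (hu : u ∈ S)
    (hrel : ¬ rel u u) (T : Finset ι) (D : ι → Finset α) (hinj : Set.InjOn D T)
    (hcut : ∀ E, IsCut rel S u E ↔ ∃ s ∈ T, D s = E) :
    numLinExt rel S =
      ∑ s ∈ T, numLinExt rel (D s) * numLinExt rel (S \ insert u (D s)) := by
  classical
  have hfin := finite_linExt rel S
  rw [numLinExt, Set.ncard_eq_toFinset_card _ hfin,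
    Finset.card_eq_sum_card_fiberwise (t := T.image D)
      (f := fun f => S.filter (fun c => f c < f u)),
    Finset.sum_image hinj]
  · refine Finset.sum_congr rfl fun s hs => ?_
    rw [← ncard_linExt_filter_eq hu hrel ((hcut (D s)).2 ⟨s, hs, rfl⟩), ← Set.ncard_coe_finset]
    congr 1
    ext f
    simp
  · intro f hf
    rw [Finset.mem_coe, Set.Finite.mem_toFinset] at hf
    rw [Finset.mem_coe, Finset.mem_image]
    exact (hcut _).1 (isCut_filter_lt hf hu)

end LinearExtensions

/-! ### Cuts of staircase shapes and the transfer relation. -/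

section StaircaseShapes

/-- Adjacency in the coordinates (row, position in the row) of an array of left-justified rows,
each of which is shifted by `w` against the previous one. -/
def RowStep (w : ℕ) (a b : ℕ × ℕ) : Prop :=
  (b.1 = a.1 ∧ b.2 = a.2 + 1) ∨ (b.1 = a.1 + 1 ∧ a.2 = b.2 + w)

/-- `n` rows of length `r`, followed by a row of length `p` and a row of length `q`. -/
def stack (r n p q : ℕ) : Finset (ℕ × ℕ) :=
  Finset.range n ×ˢ Finset.range r ∪ ({n} ×ˢ Finset.range p ∪ {n + 1} ×ˢ Finset.range q)

/-- `n` rows of length `r`, the last of which is shortened by `s`, followed by a row of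
length `w`. -/
def cutStack (r w n s : ℕ) : Finset (ℕ × ℕ) :=
  (Finset.range n ×ˢ Finset.range r).filter (fun c => c.1 + 1 = n → c.2 < r - s) ∪
    {n} ×ˢ Finset.range w

/-- The last `s` cells of a row of length `r`, followed by the cells beyond the first `w + 1` of
a row of length `p`, and by a row of length `q`. -/
def remainder (r w p q s : ℕ) : Finset (ℕ × ℕ) :=
  {0} ×ˢ Finset.Ico (r - s) r ∪ ({1} ×ˢ Finset.Ico (w + 1) p ∪ {2} ×ˢ Finset.range q)

theorem mem_stack {r n p q : ℕ} {c : ℕ × ℕ} : c ∈ stack r n p q ↔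
    (c.1 < n ∧ c.2 < r) ∨ (c.1 = n ∧ c.2 < p) ∨ (c.1 = n + 1 ∧ c.2 < q) := by
  obtain ⟨i, x⟩ := c
  simp only [stack, Finset.mem_union, Finset.mem_product, Finset.mem_singleton, Finset.mem_range]

theorem mem_cutStack {r w n s : ℕ} {c : ℕ × ℕ} : c ∈ cutStack r w n s ↔
    (c.1 < n ∧ c.2 < r ∧ (c.1 + 1 = n → c.2 < r - s)) ∨ (c.1 = n ∧ c.2 < w) := by
  obtain ⟨i, x⟩ := c
  simp only [cutStack, Finset.mem_union, Finset.mem_filter, Finset.mem_product,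
    Finset.mem_singleton, Finset.mem_range, and_assoc]

theorem mem_remainder {r w p q s : ℕ} {c : ℕ × ℕ} : c ∈ remainder r w p q s ↔
    (c.1 = 0 ∧ r - s ≤ c.2 ∧ c.2 < r) ∨ (c.1 = 1 ∧ w + 1 ≤ c.2 ∧ c.2 < p) ∨
      (c.1 = 2 ∧ c.2 < q) := by
  obtain ⟨i, x⟩ := c
  simp only [remainder, Finset.mem_union, Finset.mem_product, Finset.mem_singleton,
    Finset.mem_range, Finset.mem_Ico]

/-- This closes the recursion: the lower part of a cut is again a shape that can be cut. -/
theorem cutStack_succ (r w n s : ℕ) : cutStack r w (n + 1) s = stack r n (r - s) w := by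
  ext ⟨i, x⟩
  rw [mem_cutStack, mem_stack]
  dsimp only
  omega

/-- Translation by `k` rows. -/
def downEmb (k : ℕ) : ℕ × ℕ ↪ ℕ × ℕ :=
  ⟨fun c => (c.1 + k, c.2), fun a b h => by
    rw [Prod.mk.injEq] at h
    exact Prod.ext (by omega) h.2⟩

theorem downEmb_apply (k : ℕ) (c : ℕ × ℕ) : downEmb k c = (c.1 + k, c.2) := rfl

theorem numLinExt_map_downEmb (w k : ℕ) (S : Finset (ℕ × ℕ)) :
    numLinExt (RowStep w) (S.map (downEmb k)) = numLinExt (RowStep w) S := by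
  refine numLinExt_map _ _ fun a _ b _ => ?_
  simp only [RowStep, downEmb_apply]
  omega

theorem numLinExt_stack_sdiff {r w n p q s : ℕ} (hs : n = 0 → s = 0) (hsr : s ≤ r) :
    numLinExt (RowStep w) (stack r n p q \ insert (n, w) (cutStack r w n s)) =
      numLinExt (RowStep w) (remainder r w p q s) := by
  -- Row `n - 1` of the stack is row `0` of the remainder; moving both sides down avoids a negative
  -- shift when `n = 0`.
  rw [← numLinExt_map_downEmb w 1, ← numLinExt_map_downEmb w n (remainder r w p q s)]
  congr 1
  ext ⟨i, x⟩
  simp only [Finset.mem_map, Finset.mem_sdiff, Finset.mem_insert, mem_stack, mem_cutStack,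
    mem_remainder, downEmb_apply, Prod.exists, Prod.mk.injEq]
  constructor
  · rintro ⟨j, y, h, h1, h2⟩
    exact ⟨j + 1 - n, y, by omega, by omega, by omega⟩
  · rintro ⟨j, y, h, h1, h2⟩
    exact ⟨j + n - 1, y, by omega, by omega, by omega⟩

theorem mem_of_isCut_of_le {r w n p q : ℕ} {E : Finset (ℕ × ℕ)} {u : ℕ × ℕ}
    (hE : IsCut (RowStep w) (stack r n p q) u E) {i x y : ℕ} (hy : (i, y) ∈ E) (hxy : x ≤ y) :
    (i, x) ∈ E := by
  induction y, hxy using Nat.le_induction with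
  | base => exact hy
  | succ y _ ih =>
    refine ih (hE.lower _ ?_ _ hy (by simp [RowStep]))
    have := hE.subset hy
    rw [mem_stack] at this ⊢
    dsimp only at this ⊢
    omega

theorem isCut_cutStack {r w n p q s : ℕ} (hp : w + 1 ≤ p) (hpr : p ≤ r)
    (hs : s < max 1 (r - 2 * w)) :
    IsCut (RowStep w) (stack r n p q) (n, w) (cutStack r w n s) := by
  refine ⟨?_, ?_, ?_, ?_⟩
  · rintro ⟨i, x⟩ h
    rw [mem_cutStack] at h
    rw [mem_stack]
    dsimp only at h ⊢
    omega
  · rw [mem_cutStack]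
    dsimp only
    omega
  · rintro ⟨i, x⟩ ha ⟨j, y⟩ hb hab
    rw [mem_cutStack] at hb ⊢
    rw [mem_stack] at ha
    simp only [RowStep] at ha hb hab ⊢
    omega
  · rintro ⟨i, x⟩ ha hab
    rw [mem_stack] at ha
    rw [mem_cutStack]
    simp only [RowStep] at ha hab ⊢
    omega

/-- A cut meets each row in an initial segment. The vertical relations force all these segments
except the one directly above the pivot row, which keeps a bounded freedom. -/
theorem exists_cutStack_eq {r w n p q : ℕ} {E : Finset (ℕ × ℕ)} (hp : w + 1 ≤ p) (hpr : p ≤ r)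
    (hr : r ≤ 3 * w + 1) (hE : IsCut (RowStep w) (stack r n p q) (n, w) E) :
    ∃ s, s < max 1 (r - 2 * w) ∧ (n = 0 → s = 0) ∧ cutStack r w n s = E := by
  have hrow : ∀ x, (n, x) ∈ E ↔ x < w := by
    intro x
    constructor
    · intro hx
      by_contra hxw
      exact hE.notMem (mem_of_isCut_of_le hE hx (not_lt.1 hxw))
    · intro hx
      refine mem_of_isCut_of_le hE (y := w - 1) (hE.below _ ?_ ?_) (by omega)
      · rw [mem_stack]
        dsimp only
        omega
      · simp only [RowStep, true_and]
        omega
  -- The first cell of the row below the pivot lies directly under the pivot.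
  have hlast : ∀ x, (n + 1, x) ∉ E := by
    intro x hx
    refine hE.notMem (hE.lower _ ?_ _ (mem_of_isCut_of_le hE hx (Nat.zero_le x)) ?_)
    · rw [mem_stack]
      dsimp only
      omega
    · simp [RowStep]
  rcases n with _ | n
  · refine ⟨0, by omega, fun _ => rfl, ?_⟩
    ext ⟨i, x⟩
    rw [mem_cutStack]
    dsimp only
    constructor
    · intro h
      obtain rfl : i = 0 := by omega
      rw [hrow]
      omega
    · intro h
      have h1 := hE.subset h
      rw [mem_stack] at h1
      dsimp only at h1
      rcases i with _ | i
      · rw [hrow] at h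
        omega
      · obtain rfl : i = 0 := by omega
        exact absurd h (hlast x)
  have hprev : ∀ x, x < r → x ≤ 2 * w → (n, x) ∈ E := by
    intro x hx hx2
    by_cases h : 2 * w < r
    · refine mem_of_isCut_of_le hE (y := 2 * w) (hE.below _ ?_ ?_) hx2
      · rw [mem_stack]
        dsimp only
        omega
      · simp only [RowStep, true_and]
        omega
    · refine mem_of_isCut_of_le hE (y := r - 1)
        (hE.lower _ ?_ _ ((hrow (r - 1 - w)).2 (by omega)) ?_) (by omega)
      · rw [mem_stack]
        dsimp only
        omega
      · simp only [RowStep, true_and]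
        omega
  -- Induction upwards. The bound `r ≤ 3 * w + 1` enters here: the last cell of row `n - 1` is above
  -- position `r - 1 - w ≤ 2 * w` of row `n`, which `hprev` puts in `E`.
  have hearly : ∀ k i, i + k + 1 = n → ∀ x, x < r → (i, x) ∈ E := by
    intro k
    induction k with
    | zero =>
      intro i hi x hx
      refine mem_of_isCut_of_le hE (y := r - 1)
        (hE.lower _ ?_ _ (hprev (r - 1 - w) (by omega) (by omega)) ?_) (by omega)
      · rw [mem_stack]
        dsimp only
        omega
      · simp only [RowStep]
        omega
    | succ k ih =>
      intro i hi x hx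
      refine mem_of_isCut_of_le hE (y := r - 1)
        (hE.lower _ ?_ _ (ih (i + 1) (by omega) (r - 1 - w) (by omega)) ?_) (by omega)
      · rw [mem_stack]
        dsimp only
        omega
      · simp only [RowStep, true_and]
        omega
  have hex : ∃ t, (n, t) ∉ E :=
    ⟨r, fun h => by
      have := hE.subset h
      rw [mem_stack] at this
      dsimp only at this
      omega⟩
  classical
  obtain ⟨t, ht, htmin⟩ : ∃ t, (n, t) ∉ E ∧ ∀ x, x < t → (n, x) ∈ E :=
    ⟨Nat.find hex, Nat.find_spec hex, fun x hx => not_not.1 (Nat.find_min hex hx)⟩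
  have htE : ∀ x, (n, x) ∈ E ↔ x < t := fun x =>
    ⟨fun h => by
      by_contra hx
      exact ht (mem_of_isCut_of_le hE h (not_lt.1 hx)), htmin x⟩
  have htr : t ≤ r := by
    by_contra h
    have := hE.subset ((htE r).2 (not_le.1 h))
    rw [mem_stack] at this
    dsimp only at this
    omega
  have htw : r - t < max 1 (r - 2 * w) := by
    by_contra h
    exact ht (hprev t (by omega) (by omega))
  refine ⟨r - t, htw, by omega, ?_⟩
  ext ⟨i, x⟩
  rw [mem_cutStack]
  dsimp only
  constructor
  · rintro (⟨h1, h2, h3⟩ | ⟨rfl, h⟩)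
    · by_cases hi : i = n
      · subst hi
        exact htmin x (by omega)
      · exact hearly (n - 1 - i) i (by omega) x h2
    · exact (hrow x).2 h
  · intro h
    have h1 := hE.subset h
    rw [mem_stack] at h1
    dsimp only at h1
    by_cases hi : i = n + 1 + 1
    · subst hi
      exact absurd h (hlast x)
    · by_cases hi : i = n + 1
      · subst hi
        rw [hrow] at h
        omega
      · by_cases hi : i = n
        · subst hi
          rw [htE] at h
          omega
        · omega

/-- The number of linear extensions of `cutStack r w n s`, where for `n = 0` only `s = 0` is
counted. -/
noncomputable def cutCount (r w n s : ℕ) : ℕ :=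
  if n = 0 → s = 0 then numLinExt (RowStep w) (cutStack r w n s) else 0

theorem numLinExt_stack {r w p q : ℕ} (n : ℕ) (hp : w + 1 ≤ p) (hpr : p ≤ r)
    (hr : r ≤ 3 * w + 1) :
    numLinExt (RowStep w) (stack r n p q) =
      ∑ s ∈ Finset.range (max 1 (r - 2 * w)),
        cutCount r w n s * numLinExt (RowStep w) (remainder r w p q s) := by
  have hu : (n, w) ∈ stack r n p q := by
    rw [mem_stack]
    dsimp only
    omega
  rw [numLinExt_eq_sum hu (by simp [RowStep])
    ((Finset.range (max 1 (r - 2 * w))).filter (fun s => n = 0 → s = 0)) (cutStack r w n),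
    Finset.sum_filter]
  · refine Finset.sum_congr rfl fun s hs => ?_
    rw [Finset.mem_range] at hs
    by_cases h : n = 0 → s = 0
    · rw [if_pos h, cutCount, if_pos h, numLinExt_stack_sdiff h (by omega)]
    · rw [if_neg h, cutCount, if_neg h, zero_mul]
  · intro s hs t ht hst
    simp only [Finset.coe_filter, Finset.mem_range, Set.mem_ofPred_eq] at hs ht
    by_contra hne
    -- For `n > 0` the length of row `n - 1` recovers `s`; for `n = 0` only `s = 0` is allowed.
    have key : ∀ x, (n - 1, x) ∈ cutStack r w n s ↔ (n - 1, x) ∈ cutStack r w n t := fun x => by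
      rw [hst]
    simp only [mem_cutStack] at key
    have h1 := key (r - s)
    have h2 := key (r - t)
    omega
  · intro E
    constructor
    · intro hE
      obtain ⟨s, h1, h2, h3⟩ := exists_cutStack_eq hp hpr hr hE
      exact ⟨s, by simpa using ⟨by simpa using h1, h2⟩, h3⟩
    · rintro ⟨s, hs, rfl⟩
      rw [Finset.mem_filter, Finset.mem_range] at hs
      exact isCut_cutStack hp hpr hs.1

/-- The row shortened by `s` still has a cell at position `w`, so it can serve as the next pivot
row. -/
theorem cutCount_succ {r w : ℕ} (n s : ℕ) (hw : w + 1 ≤ r) (hr : r ≤ 3 * w + 1)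
    (hs : s < max 1 (r - 2 * w)) :
    cutCount r w (n + 1) s =
      ∑ t ∈ Finset.range (max 1 (r - 2 * w)),
        cutCount r w n t * numLinExt (RowStep w) (remainder r w (r - s) w t) := by
  rw [cutCount, if_pos (by omega), cutStack_succ, numLinExt_stack n (by omega) (by omega) hr]

end StaircaseShapes

/-! ### Transfer matrix and Cayley-Hamilton. -/

section Recurrence

open Matrix Polynomial

/-- The scalar sequence `y ⬝ Mⁿ v` of a `d × d` matrix satisfies a linear recurrence of
order `d`. -/
theorem exists_recurrence_dotProduct_pow_mulVec {K : Type*} [CommRing K] {d : ℕ}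
    (M : Matrix (Fin d) (Fin d) K) (v y : Fin d → K) :
    ∃ a : ℕ → K, ∀ n, d < n → y ⬝ᵥ (M ^ (n - 1)) *ᵥ v =
      ∑ k ∈ Finset.Icc 1 d, a k * (y ⬝ᵥ (M ^ (n - k - 1)) *ᵥ v) := by
  nontriviality K
  refine ⟨fun k => -M.charpoly.coeff (d - k), fun n hn => ?_⟩
  have hCH : M ^ d = ∑ i ∈ Finset.range d, (-M.charpoly.coeff i) • M ^ i := by
    have h := M.aeval_self_charpoly
    rw [aeval_eq_sum_range, M.charpoly_natDegree_eq_dim, Fintype.card_fin,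
      Finset.sum_range_succ] at h
    have hlead : M.charpoly.coeff d = 1 := by
      have := M.charpoly_monic.coeff_natDegree
      rwa [M.charpoly_natDegree_eq_dim, Fintype.card_fin] at this
    rw [hlead, one_smul] at h
    rw [eq_neg_of_add_eq_zero_right h, ← Finset.sum_neg_distrib]
    simp
  -- Here `d < n` makes the exponent `n - 1 - d` a genuine difference.
  have hpow : M ^ (n - 1) =
      ∑ i ∈ Finset.range d, (-M.charpoly.coeff i) • M ^ (i + (n - 1 - d)) := by
    conv_lhs => rw [show n - 1 = d + (n - 1 - d) by omega, pow_add, hCH, Finset.sum_mul]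
    simp [pow_add]
  rw [hpow, Matrix.sum_mulVec, dotProduct_sum]
  refine Finset.sum_bij' (fun i _ => d - i) (fun k _ => d - k) ?_ ?_ ?_ ?_ ?_
  · intro i hi
    simp only [Finset.mem_range, Finset.mem_Icc] at hi ⊢
    omega
  · intro i hi
    simp only [Finset.mem_range, Finset.mem_Icc] at hi ⊢
    omega
  · intro i hi
    simp only [Finset.mem_range] at hi
    omega
  · intro i hi
    simp only [Finset.mem_Icc] at hi
    omega
  · intro i hi
    simp only [Finset.mem_range] at hi
    dsimp only
    rw [smul_mulVec, dotProduct_smul, smul_eq_mul, show d - (d - i) = i by omega,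
      show n - (d - i) - 1 = i + (n - 1 - d) by omega]

theorem exists_recurrence_numLinExt_stack {r w : ℕ} (hw : w + 1 ≤ r) (hr : r ≤ 3 * w + 1) :
    ∃ a : ℕ → ℝ, ∀ n, max 1 (r - 2 * w) < n →
      (numLinExt (RowStep w) (stack r (n - 1) r 0) : ℝ) =
        ∑ k ∈ Finset.Icc 1 (max 1 (r - 2 * w)),
          a k * (numLinExt (RowStep w) (stack r (n - k - 1) r 0) : ℝ) := by
  set d := max 1 (r - 2 * w) with hd
  let M : Matrix (Fin d) (Fin d) ℝ :=
    -- The entry counts the orderings after the pivot of the upper cut `t`, inside the lower part of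
    -- the next cut `s`.
    Matrix.of fun s t => (numLinExt (RowStep w) (remainder r w (r - s) w t) : ℝ)
  let v : Fin d → ℝ := fun s => cutCount r w 0 s
  let y : Fin d → ℝ := fun s => numLinExt (RowStep w) (remainder r w r 0 s)
  have hM : ∀ n, (M ^ n) *ᵥ v = fun s : Fin d => (cutCount r w n s : ℝ) := by
    intro n
    induction n with
    | zero => simp [v]
    | succ n ih =>
      rw [pow_succ', ← Matrix.mulVec_mulVec, ih]
      funext s
      rw [cutCount_succ n s hw hr s.2, ← hd, Finset.sum_range]
      simp [Matrix.mulVec, dotProduct, M, mul_comm]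
  have hA : ∀ n, (numLinExt (RowStep w) (stack r n r 0) : ℝ) = y ⬝ᵥ (M ^ n) *ᵥ v := by
    intro n
    rw [hM, numLinExt_stack n hw le_rfl hr, ← hd, Finset.sum_range]
    simp [dotProduct, y, mul_comm]
  obtain ⟨a, ha⟩ := exists_recurrence_dotProduct_pow_mulVec M v y
  refine ⟨a, fun n hn => ?_⟩
  simp only [hA]
  exact ha n hn

end Recurrence

/-! ### From lattice cells to staircase coordinates. -/

section Cells

/-- Adjacency of cells, in the direction in which standard Young tableaux increase. -/
def CellStep (a b : Cell) : Prop := b = (a.1, a.2 + 1) ∨ b = (a.1 + 1, a.2)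

theorem numSYT_eq_numLinExt (S : Finset Cell) : numSYT S = numLinExt CellStep S := by
  symm
  refine Set.ncard_congr (fun f _ c => f c) ?_ ?_ ?_
  · rintro f ⟨-, hinj, hr, hm⟩
    exact ⟨fun a b h => Subtype.ext (hinj a a.2 b b.2 h), fun c => hr c c.2,
      fun i j h h' => hm _ h _ h' (Or.inl rfl), fun i j h h' => hm _ h _ h' (Or.inr rfl)⟩
  · intro f g hf hg h
    funext c
    by_cases hc : c ∈ S
    · exact congrFun h ⟨c, hc⟩
    · rw [hf.1 c hc, hg.1 c hc]
  · rintro g ⟨hinj, hr, hm1, hm2⟩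
    refine ⟨fun c => if h : c ∈ S then g ⟨c, h⟩ else 0, ⟨?_, ?_, ?_, ?_⟩, ?_⟩
    · intro c hc
      simp [hc]
    · intro a ha b hb h
      simp only [ha, hb, dif_pos] at h
      exact congrArg Subtype.val (hinj h)
    · intro c hc
      simp only [hc, dif_pos]
      exact hr ⟨c, hc⟩
    · rintro ⟨i, j⟩ ha b hb (rfl | rfl)
      · simp only [ha, hb, dif_pos]
        exact hm1 i j ha hb
      · simp only [ha, hb, dif_pos]
        exact hm2 i j ha hb
    · funext c
      simp

/-- The cell in row `i` and position `x` of the array of rows that are shifted by `w` against each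
other, starting at the cell `(1, l)`. -/
def staircaseEmb (l : ℤ) (w : ℕ) : ℕ × ℕ ↪ Cell :=
  ⟨fun c => (1 + c.1, l + c.1 * w + c.2), fun a b h => by
    rw [Prod.mk.injEq] at h
    have h1 : a.1 = b.1 := by omega
    rw [h1] at h
    exact Prod.ext h1 (by omega)⟩

theorem staircaseEmb_apply (l : ℤ) (w : ℕ) (c : ℕ × ℕ) :
    staircaseEmb l w c = (1 + (c.1 : ℤ), l + c.1 * w + c.2) := rfl

theorem numSYT_map_staircaseEmb (l : ℤ) (w : ℕ) (S : Finset (ℕ × ℕ)) :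
    numSYT (S.map (staircaseEmb l w)) = numLinExt (RowStep w) S := by
  rw [numSYT_eq_numLinExt]
  refine numLinExt_map _ _ fun a _ b _ => ?_
  obtain ⟨i, x⟩ := a
  obtain ⟨j, y⟩ := b
  simp only [CellStep, RowStep, staircaseEmb_apply, Prod.mk.injEq]
  refine or_congr ⟨?_, ?_⟩ ⟨?_, ?_⟩
  · rintro ⟨h1, h2⟩
    obtain rfl : j = i := by omega
    omega
  · rintro ⟨rfl, h⟩
    omega
  · rintro ⟨h1, h2⟩
    obtain rfl : j = i + 1 := by omega
    push_cast at h2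
    rw [add_mul] at h2
    omega
  · rintro ⟨rfl, h⟩
    push_cast
    rw [add_mul]
    omega

/-- Young diagrams are closed to the left, so a row of a skew shape has no gaps. -/
theorem exists_eq_singleton_product_Ico {R : Finset Cell} (hrow : IsSingleRow R)
    (h11 : ((1, 1) : Cell) ∈ R) (hskew : IsFrenchSkewShape R) :
    ∃ l : ℤ, R = {1} ×ˢ Finset.Ico l (l + R.card) := by
  have h1 : ∀ c ∈ R, c.1 = 1 := fun c hc => hrow c hc _ h11
  have hconv : ∀ j k m : ℤ, ((1, j) : Cell) ∈ R → ((1, m) : Cell) ∈ R → j ≤ k → k ≤ m →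
      ((1, k) : Cell) ∈ R := by
    intro j k m hj hm hjk hkm
    obtain ⟨lam, mu, t, -, rfl⟩ := hskew
    simp only [Finset.mem_image, Finset.mem_sdiff, YoungDiagram.mem_cells, Prod.mk.injEq,
      Prod.exists] at hj hm ⊢
    obtain ⟨a, b, ⟨hb, hb'⟩, ha, hj⟩ := hj
    obtain ⟨a', b', ⟨hc, hc'⟩, ha', hm⟩ := hm
    obtain rfl : a = a' := by omega
    refine ⟨a, (k - t.2).toNat, ⟨lam.up_left_mem le_rfl (by omega) hc,
      fun h => hb' (mu.up_left_mem le_rfl (by omega) h)⟩, ha, by omega⟩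
  let C : Finset ℤ := R.image Prod.snd
  have hC : ∀ k, k ∈ C ↔ ((1, k) : Cell) ∈ R := by
    intro k
    rw [Finset.mem_image]
    constructor
    · rintro ⟨⟨i, j⟩, hc, rfl⟩
      obtain rfl : i = 1 := h1 _ hc
      exact hc
    · intro h
      exact ⟨_, h, rfl⟩
  have hne : C.Nonempty := ⟨1, (hC 1).2 h11⟩
  have hR : R = {1} ×ˢ Finset.Icc (C.min' hne) (C.max' hne) := by
    ext ⟨i, k⟩
    rw [Finset.mem_product, Finset.mem_singleton, Finset.mem_Icc]
    constructor
    · intro h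
      obtain rfl : i = 1 := h1 _ h
      exact ⟨rfl, C.min'_le _ ((hC k).2 h), C.le_max' _ ((hC k).2 h)⟩
    · rintro ⟨h, h2, h3⟩
      dsimp only at h h2 h3
      subst h
      exact hconv _ _ _ ((hC _).1 (C.min'_mem hne)) ((hC _).1 (C.max'_mem hne)) h2 h3
  have hle : C.min' hne ≤ C.max' hne := C.min'_le _ (C.max'_mem hne)
  have hcard : (R.card : ℤ) = C.max' hne + 1 - C.min' hne := by
    have h := congrArg Finset.card hR
    rw [Finset.card_product, Finset.card_singleton, Int.card_Icc] at h
    omega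
  refine ⟨C.min' hne, hR.trans ?_⟩
  rw [hcard]
  ext ⟨i, k⟩
  simp only [Finset.mem_product, Finset.mem_singleton, Finset.mem_Icc, Finset.mem_Ico]
  omega

theorem shiftVec_of_isSingleRow {R : Finset Cell} (hrow : IsSingleRow R)
    (h11 : ((1, 1) : Cell) ∈ R) (w : ℕ) : shiftVec R w = (1, (w : ℤ)) := by
  have hset : {i : ℤ | ∃ j, (i, j) ∈ R} = {1} := by
    ext i
    exact ⟨fun ⟨j, hj⟩ => hrow _ hj _ h11, fun h => ⟨1, by rw [h]; exact h11⟩⟩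
  simp [shiftVec, topRow, bottomRow, hset]

theorem Sh_eq_map_stack {R : Finset Cell} {w r : ℕ} {l : ℤ} (hvec : shiftVec R w = (1, (w : ℤ)))
    (hR : R = {1} ×ˢ Finset.Ico l (l + r)) (n : ℕ) :
    Sh w R (n + 1) = (stack r n r 0).map (staircaseEmb l w) := by
  ext ⟨i, j⟩
  simp only [Sh, hvec, shiftCells, Finset.mem_biUnion, Finset.mem_range, Finset.mem_image,
    Finset.mem_map, mem_stack, staircaseEmb_apply, Prod.exists,
    Prod.mk.injEq, Prod.smul_mk, Prod.mk_add_mk, smul_eq_mul, mul_one]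
  constructor
  · rintro ⟨k, hk, a, b, hab, hi, hj⟩
    rw [hR, Finset.mem_product, Finset.mem_singleton, Finset.mem_Ico] at hab
    dsimp only at hab
    exact ⟨k, (b - l).toNat, by omega, by omega, by omega⟩
  · rintro ⟨k, x, hx, hi, hj⟩
    refine ⟨k, by omega, 1, l + x, ?_, by omega, by omega⟩
    rw [hR, Finset.mem_product, Finset.mem_singleton, Finset.mem_Ico]
    dsimp only
    omega

/-- If `r ≤ w`, the second row starts to the right of every cell of the first, so no vertical step
joins them. The bound ensures that the pivot at position `w` exists. -/
theorem lt_of_isConnectedShape_Sh_two {R : Finset Cell} {w r : ℕ} {l : ℤ}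
    (hvec : shiftVec R w = (1, (w : ℤ))) (hR : R = {1} ×ˢ Finset.Ico l (l + r))
    (h11 : ((1, 1) : Cell) ∈ R) (hconn : IsConnectedShape (Sh w R 2)) : w < r := by
  have hmem : ∀ c : Cell, c ∈ Sh w R 2 ↔ (c.1 = 1 ∧ l ≤ c.2 ∧ c.2 < l + r) ∨
      (c.1 = 2 ∧ l + w ≤ c.2 ∧ c.2 < l + w + r) := by
    rintro ⟨i, j⟩
    rw [Sh_eq_map_stack hvec hR 1]
    simp only [Finset.mem_map, mem_stack, staircaseEmb_apply, Prod.exists,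
      Prod.mk.injEq]
    constructor
    · rintro ⟨k, x, hx, rfl, rfl⟩
      obtain rfl | rfl : k = 0 ∨ k = 1 := by omega
      · exact Or.inl ⟨by norm_num, by push_cast; omega, by push_cast; omega⟩
      · exact Or.inr ⟨by norm_num, by push_cast; omega, by push_cast; omega⟩
    · rintro (⟨rfl, h1, h2⟩ | ⟨rfl, h1, h2⟩)
      · exact ⟨0, (j - l).toNat, by omega, by omega, by push_cast; omega⟩
      · exact ⟨1, (j - l - w).toNat, by omega, by omega, by push_cast; omega⟩
  rw [hR, Finset.mem_product, Finset.mem_singleton, Finset.mem_Ico] at h11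
  dsimp only at h11
  by_contra hrw
  have hpath := hconn (1, 1) ((hmem _).2 (by dsimp only; omega)) (2, 1 + w)
    ((hmem _).2 (by dsimp only; omega))
  have key : ∀ v : Cell, Relation.ReflTransGen (fun a b : Cell => b ∈ Sh w R 2 ∧
      b - a ∈ ({(1, 0), (0, 1), (-1, 0), (0, -1)} : Set Cell)) (1, 1) v →
      v.1 = 1 ∧ v.2 < l + r := by
    intro v hv
    induction hv with
    | refl => exact ⟨rfl, h11.2.2⟩
    | tail _ hstep ih =>
      obtain ⟨h1, h2⟩ := hstep
      rw [hmem] at h1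
      simp only [Set.mem_insert_iff, Set.mem_singleton_iff, Prod.ext_iff, Prod.fst_sub,
        Prod.snd_sub] at h2
      omega
  have := (key _ hpath).1
  norm_num at this

end Cells

end PeriodicSYT

theorem mainTheorem5 (R : Finset PeriodicSYT.Cell) (w : ℕ)
    (hrow : PeriodicSYT.IsSingleRow R) (h11 : ((1, 1) : PeriodicSYT.Cell) ∈ R)
    (hcomp : PeriodicSYT.IsCompatible R w) (hcard : R.card ≤ 3 * w + 1) :
    ∃ d : ℕ, 1 ≤ d ∧ d ≤ max 1 (R.card - 2 * w) ∧
      ∃ a : ℕ → ℝ, ∀ n : ℕ, PeriodicSYT.threshold R w ≤ n → d < n →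
        (PeriodicSYT.numSYT (PeriodicSYT.Sh w R n) : ℝ) =
          ∑ k ∈ Finset.Icc 1 d,
            a k * (PeriodicSYT.numSYT (PeriodicSYT.Sh w R (n - k)) : ℝ) := by
  obtain ⟨l, hR⟩ := PeriodicSYT.exists_eq_singleton_product_Ico hrow h11 hcomp.1.2.1
  have hvec := PeriodicSYT.shiftVec_of_isSingleRow hrow h11 w
  have hw := PeriodicSYT.lt_of_isConnectedShape_Sh_two hvec hR h11
    (hcomp.2.1 2 (by norm_num)).2.2.1
  -- The last of the `n` rows is split off as the pivot row, hence `n - 1` and an empty row after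
  -- it.
  have hnum : ∀ n, 1 ≤ n → PeriodicSYT.numSYT (PeriodicSYT.Sh w R n) =
      PeriodicSYT.numLinExt (PeriodicSYT.RowStep w) (PeriodicSYT.stack R.card (n - 1) R.card 0) := by
    intro n hn
    obtain ⟨n, rfl⟩ := Nat.exists_eq_add_of_le' hn
    rw [PeriodicSYT.Sh_eq_map_stack hvec hR, PeriodicSYT.numSYT_map_staircaseEmb,
      Nat.add_sub_cancel]
  obtain ⟨a, ha⟩ := PeriodicSYT.exists_recurrence_numLinExt_stack hw hcard
  refine ⟨max 1 (R.card - 2 * w), le_max_left _ _, le_rfl, a, fun n _ hn => ?_⟩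
  rw [hnum n (by omega), ha n hn]
  refine Finset.sum_congr rfl fun k hk => ?_
  rw [Finset.mem_Icc] at hk
  rw [hnum (n - k) (by omega)]
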